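/- Let a group $G$ act on $\mathbb{C}^n$, and let $P:\mathbb{C}^n\to\mathbb{C}^N$ be a polynomial map that is $G$-invariant, i.e. $P(gx)=P(x)$ for all $g\in G$ and $x\in\mathbb{C}^n$, such that the induced map on the space of orbits $\tilde P:\mathbb{C}^n/G\to\mathbb{C}^N$, $\tilde P([x])=P(x)$, is injective. Then for every integer $k\ge 2n+1$ and for a generic linear map $\ell:\mathbb{C}^N\to\mathbb{C}^k$, the map $\ell\circ\tilde P:\mathbb{C}^n/G\to\mathbb{C}^k$ is injective. Here "for a generic $\ell$" means: for all $\ell$ in some nonempty Zariski-open subset of the space $\operatorname{Hom}(\mathbb{C}^N,\mathbb{C}^k)\cong\mathbb{C}^{k\times N}$ of linear maps. -/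

import Mathlib

/-- A polynomial map `ℂⁿ → ℂᴺ`: each component is given by a polynomial in `n` variables. -/
def IsPolynomialMap {n N : ℕ} (P : (Fin n → ℂ) → (Fin N → ℂ)) : Prop :=
  ∃ p : Fin N → MvPolynomial (Fin n) ℂ, ∀ x i, P x i = MvPolynomial.eval x (p i)

/-- A map `P` is `G`-invariant if it is constant along the action: `P (g • x) = P x`. -/
def IsInvariantMap (G : Type*) [Group G] {X Y : Type*} [MulAction G X] (P : X → Y) : Prop :=
  ∀ (g : G) (x : X), P (g • x) = P x

/-- The map `X / G → Y` on the space of orbits, induced by a `G`-invariant map `X → Y`. -/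
def IsInvariantMap.induced {G : Type*} [Group G] {X Y : Type*} [MulAction G X] {P : X → Y}
    (hP : IsInvariantMap G P) : MulAction.orbitRel.Quotient G X → Y :=
  Quotient.lift P (by
    rintro _ b ⟨g, rfl⟩
    exact hP g b)

/-- The space of linear maps `ℂᴺ → ℂᵏ` as the affine space with the matrix entries as
coordinates. -/
def linearMapCoords {N k : ℕ} (l : (Fin N → ℂ) →ₗ[ℂ] (Fin k → ℂ)) : Fin k × Fin N → ℂ :=
  fun ij => LinearMap.toMatrix' l ij.1 ij.2

/-- A set of linear maps `ℂᴺ → ℂᵏ` is Zariski open if it is the complement of the common zero set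
of an ideal of polynomials in the `k * N` matrix entries. -/
def IsZariskiOpen {N k : ℕ} (U : Set ((Fin N → ℂ) →ₗ[ℂ] (Fin k → ℂ))) : Prop :=
  ∃ I : Ideal (MvPolynomial (Fin k × Fin N) ℂ),
    U = {l | linearMapCoords l ∉ MvPolynomial.zeroLocus ℂ I}

/-- A property holds for a generic linear map `ℂᴺ → ℂᵏ` if it holds for all members of some
nonempty Zariski open set (which is dense, since affine space is irreducible). -/
def ForGenericLinearMap {N k : ℕ} (Q : ((Fin N → ℂ) →ₗ[ℂ] (Fin k → ℂ)) → Prop) : Prop :=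
  ∃ U : Set ((Fin N → ℂ) →ₗ[ℂ] (Fin k → ℂ)), IsZariskiOpen U ∧ U.Nonempty ∧ ∀ l ∈ U, Q l

/-! Injectivity fails only if `l` kills some nonzero `P x - P y`, a vector depending on `2n`
parameters. If its `j`-th entry is nonzero, column `j` of the matrix is determined by the other
columns and `(x, y)`. Such matrices thus depend on `2n + k(N - 1) < kN` parameters, so they satisfy
a nontrivial equation `Q j`. Off the zero set of `∏ j, Q j`, no such vector is killed. -/

/-- More polynomials than variables are algebraically dependent. -/
theorem exists_ne_zero_aeval_eq_zero_of_card_lt {K σ τ : Type} [Field K] [Fintype σ] [Fintype τ]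
    (h : Fintype.card σ < Fintype.card τ) (p : τ → MvPolynomial σ K) :
    ∃ Q : MvPolynomial τ K, Q ≠ 0 ∧ MvPolynomial.aeval p Q = 0 := by
  by_contra! hQ
  have hp : AlgebraicIndependent K p :=
    (injective_iff_map_eq_zero _).2 fun Q hz => by_contra fun hne => hQ Q hne hz
  have hle := hp.cardinalMk_le_trdeg
  rw [MvPolynomial.trdeg_of_isDomain] at hle
  simp only [Cardinal.mk_fintype, Cardinal.lift_natCast, Nat.cast_le] at hle
  omega

/-- For a polynomial family of vectors depending on fewer than `k` parameters, the `k`-rowed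
matrices annihilating some member with nonzero `j`-th entry satisfy a common
nontrivial polynomial equation. -/
theorem exists_ne_zero_eval_eq_zero_of_mulVec_eq_zero {K : Type} [Field K] {s N k : ℕ} (hk : s < k)
    (F : Fin N → MvPolynomial (Fin s) K) (j : Fin N) :
    ∃ Q : MvPolynomial (Fin k × Fin N) K, Q ≠ 0 ∧
      ∀ (A : Fin k × Fin N → K) (x : Fin s → K), MvPolynomial.eval x (F j) ≠ 0 →
        (∀ i, ∑ m, A (i, m) * MvPolynomial.eval x (F m) = 0) → MvPolynomial.eval A Q = 0 := by
  classical
  let σ := Fin s ⊕ Fin k × {m : Fin N // m ≠ j}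
  let F' : Fin N → MvPolynomial σ K := fun m => MvPolynomial.rename Sum.inl (F m)
  -- Solving `A F = 0` for column `j` would divide by `F j`; taking the other entries as `F j` times
  -- free variables keeps the parametrization polynomial.
  let p : Fin k × Fin N → MvPolynomial σ K := fun im =>
    if hm : im.2 = j then -∑ m : {m : Fin N // m ≠ j}, MvPolynomial.X (Sum.inr (im.1, m)) * F' m
    else F' j * MvPolynomial.X (Sum.inr (im.1, ⟨im.2, hm⟩))
  have hcard : Fintype.card σ < Fintype.card (Fin k × Fin N) := by
    have hN : 0 < N := j.pos
    obtain ⟨M, rfl⟩ : ∃ M, N = M + 1 := ⟨N - 1, by omega⟩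
    simp only [σ, Fintype.card_sum, Fintype.card_prod, Fintype.card_fin, ne_eq,
      Fintype.card_subtype_compl, Fintype.card_subtype_eq, Nat.add_sub_cancel]
    rw [Nat.mul_succ]
    omega
  obtain ⟨Q, hQ, hQp⟩ := exists_ne_zero_aeval_eq_zero_of_card_lt hcard p
  refine ⟨Q, hQ, fun A x hx hA => ?_⟩
  let y : σ → K := Sum.elim x fun im => A (im.1, im.2) / MvPolynomial.eval x (F j)
  have hF' : ∀ m, MvPolynomial.eval y (F' m) = MvPolynomial.eval x (F m) := fun m => by
    simp only [F', MvPolynomial.eval_rename]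
    rfl
  have hy : (fun im => MvPolynomial.eval y (p im)) = A := by
    funext ⟨i, m⟩
    by_cases hm : m = j
    · subst hm
      have hi := hA i
      rw [Fintype.sum_eq_add_sum_subtype_ne _ m] at hi
      simp only [p, dif_pos, map_neg, map_sum, map_mul, MvPolynomial.eval_X, hF', y, Sum.elim_inr]
      rw [← mul_left_inj' hx, eq_neg_of_add_eq_zero_left hi, neg_mul, Finset.sum_mul]
      congr 1
      exact Finset.sum_congr rfl fun a _ => by field_simp
    · simp only [p, dif_neg hm, map_mul, MvPolynomial.eval_X, hF', y, Sum.elim_inr]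
      field_simp
  rw [← hy, ← map_zero (MvPolynomial.eval y), ← hQp]
  have hcomp := MvPolynomial.comp_aeval_apply (f := p) (MvPolynomial.aeval y) Q
  simpa only [MvPolynomial.aeval_eq_eval] using hcomp.symm

/-- A nonzero polynomial in the matrix entries defines a nonempty Zariski open set. -/
theorem forGenericLinearMap_of_eval_ne_zero {N k : ℕ}
    {R : ((Fin N → ℂ) →ₗ[ℂ] (Fin k → ℂ)) → Prop} (Q : MvPolynomial (Fin k × Fin N) ℂ) (hQ : Q ≠ 0)
    (h : ∀ l, MvPolynomial.eval (linearMapCoords l) Q ≠ 0 → R l) : ForGenericLinearMap R := by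
  refine ⟨{l | MvPolynomial.eval (linearMapCoords l) Q ≠ 0}, ⟨Ideal.span {Q}, ?_⟩, ?_, h⟩
  · ext l
    simp [MvPolynomial.zeroLocus_span, MvPolynomial.aeval_eq_eval]
  · obtain ⟨A, hA⟩ : ∃ A, MvPolynomial.eval A Q ≠ 0 := by
      by_contra! hz
      exact hQ (MvPolynomial.funext fun A => by rw [hz, map_zero])
    refine ⟨Matrix.toLin' (Matrix.of fun i m => A (i, m)), ?_⟩
    have : linearMapCoords (Matrix.toLin' (Matrix.of fun i m => A (i, m))) = A := by
      funext im
      simp [linearMapCoords]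
    change MvPolynomial.eval (linearMapCoords _) Q ≠ 0
    rwa [this]

theorem mainTheorem2 {G : Type*} [Group G] {n N : ℕ} [MulAction G (Fin n → ℂ)]
    (P : (Fin n → ℂ) → (Fin N → ℂ)) (hpoly : IsPolynomialMap P) (hinv : IsInvariantMap G P)
    (hinj : Function.Injective hinv.induced) (k : ℕ) (hk : 2 * n + 1 ≤ k) :
    ForGenericLinearMap
      (fun l : (Fin N → ℂ) →ₗ[ℂ] (Fin k → ℂ) => Function.Injective (l ∘ hinv.induced)) := by
  obtain ⟨p, hp⟩ := hpoly
  let F : Fin N → MvPolynomial (Fin (n + n)) ℂ := fun m =>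
    MvPolynomial.rename (Fin.castAdd n) (p m) - MvPolynomial.rename (Fin.natAdd n) (p m)
  have hF : ∀ x y m, MvPolynomial.eval (Fin.append x y) (F m) = P x m - P y m := fun x y m => by
    simp only [F, map_sub, MvPolynomial.eval_rename, hp]
    congr 3 <;> funext i
    exacts [Fin.append_left x y i, Fin.append_right x y i]
  choose Q hQ hQF using fun j =>
    exists_ne_zero_eval_eq_zero_of_mulVec_eq_zero (show n + n < k by omega) F j
  refine forGenericLinearMap_of_eval_ne_zero (∏ j, Q j) (Finset.prod_ne_zero_iff.2 fun j _ => hQ j)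
    fun l hl a b hab => hinj ?_
  induction a using Quotient.inductionOn with | _ x
  induction b using Quotient.inductionOn with | _ y
  change l (P x) = l (P y) at hab
  change P x = P y
  rw [map_prod, Finset.prod_ne_zero_iff] at hl
  funext j
  by_contra hj
  refine hl j (Finset.mem_univ j) (hQF j _ (Fin.append x y) ?_ fun i => ?_)
  · rwa [hF, sub_ne_zero]
  · have h0 : l (P x - P y) = 0 := by rw [map_sub, hab, sub_self]
    rw [← LinearMap.toMatrix'_mulVec] at h0
    simpa [hF, linearMapCoords, Matrix.mulVec, dotProduct] using congrFun h0 i
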